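/- Let $q$ be a complex number with $|q|<1$. Write $(A)_n=\prod_{k=0}^{n-1}(1-Aq^k)$ for $n\ge 0$ and $(A)_\infty=\lim_{n\to\infty}(A)_n$. For an integer partition $\pi$ let $|\pi|$ be the sum of its parts, $\#(\pi)$ the number of its parts and $s(\pi)$ its smallest part, with $s(\emptyset)=\infty$ for the empty partition. Let $S$ be the set of triples $\vec\pi=(\pi_1,\pi_2,\pi_3)$ of (possibly empty) integer partitions such that $\pi_1$ has distinct parts, $1\le s(\pi_1)<\infty$ and $s(\pi_1)\le\min(s(\pi_2),s(\pi_3))$. Put $|\vec\pi|=|\pi_1|+|\pi_2|+|\pi_3|$, $\omega_1(\vec\pi)=(-1)^{\#(\pi_1)-1}$ and $\imath(\pi_1,\pi_2,\pi_3)=(\pi_1,\pi_3,\pi_2)$, and define $$N_{\mathrm{SC}}(n)=\sum_{\substack{\vec\pi\in S,\ |\vec\pi|=n\\ \imath(\vec\pi)=\vec\pi}}\omega_1(\vec\pi).$$ Then the three series below converge absolutely, and $$(q)_\infty\sum_{n=1}^\infty N_{\mathrm{SC}}(n)q^n+\frac12\,\frac{(q)_\infty}{(-q)_\infty}\sum_{n=1}^\infty\frac{q^{n(n+1)/2}}{(1-q^n)(q)_n}\left(\frac{(-q)_n}{(q)_n}-1\right)$$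 $$=\frac14-\frac14\,\frac{(q)_\infty}{(-q)_\infty}+\frac12\,\frac{(q)_\infty}{(-q)_\infty}\sum_{n=1}^\infty\frac{(-q)_n}{(q)_n}\,\frac{q^n}{1-q^n}.$$ -/

import Mathlib

open Filter Topology

namespace QSeries

/-- The finite `q`-shifted factorial `(A; q)_n = (1 - A) (1 - A q) ⋯ (1 - A q ^ (n - 1))`. -/
def qPoch (A q : ℂ) (n : ℕ) : ℂ := ∏ k ∈ Finset.range n, (1 - A * q ^ k)

/-- The infinite `q`-shifted factorial `(A; q)_∞ = lim_{n → ∞} (A; q)_n`. -/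
noncomputable def qPochInf (A q : ℂ) : ℂ := limUnder atTop (qPoch A q)

theorem summable_norm_neg_mul_pow (A : ℂ) {q : ℂ} (hq : ‖q‖ < 1) :
    Summable fun k : ℕ => ‖-(A * q ^ k)‖ := by
  simp only [norm_neg, norm_mul, norm_pow]
  exact (summable_geometric_of_lt_one (norm_nonneg q) hq).mul_left _

/-- For `|q| < 1` the limit that defines `(A; q)_∞` exists. -/
theorem tendsto_qPoch (A : ℂ) {q : ℂ} (hq : ‖q‖ < 1) :
    Tendsto (qPoch A q) atTop (𝓝 (qPochInf A q)) := by
  have h := (multipliable_one_add_of_summable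
    (summable_norm_neg_mul_pow A hq)).tendsto_prod_tprod_nat
  simp only [← sub_eq_add_neg] at h
  exact tendsto_nhds_limUnder ⟨_, h⟩

/-- For `|q| < 1` the infinite product `(-q; q)_∞` does not vanish. -/
theorem qPochInf_neg_ne_zero {q : ℂ} (hq : ‖q‖ < 1) : qPochInf (-q) q ≠ 0 := by
  have hs := summable_norm_neg_mul_pow (-q) hq
  have h := (multipliable_one_add_of_summable hs).tendsto_prod_tprod_nat
  have h0 : ∏' k : ℕ, (1 + -(-q * q ^ k)) ≠ 0 := by
    refine tprod_one_add_ne_zero_of_summable (fun k hk => ?_) hs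
    have h1 : q ^ (k + 1) = -1 := by linear_combination hk
    have h2 : ‖q‖ ^ (k + 1) = 1 := by rw [← norm_pow, h1]; simp
    exact absurd h2 (pow_lt_one₀ (norm_nonneg q) hq (Nat.succ_ne_zero k)).ne
  simp only [← sub_eq_add_neg] at h h0
  rwa [tendsto_nhds_unique (tendsto_qPoch (-q) hq) h]

/-- Integer partitions of arbitrary size (`π.1` is the number that is partitioned, `π.2` the
partition); the empty partition, of size `0`, is included. -/
abbrev IntPartition : Type := Σ n : ℕ, n.Partition

/-- The number of parts `#(π)`. -/
def numParts (π : IntPartition) : ℕ := π.2.parts.card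

/-- The smallest part `s(π)`, equal to `∞` for the empty partition. -/
noncomputable def smallestPart (π : IntPartition) : ℕ∞ := (π.2.parts.map (fun i : ℕ => (i : ℕ∞))).inf

/-- The set `V = 𝒟 × 𝒫 × 𝒫` of vector partitions: the first component has distinct parts. -/
def vectorPartitions : Set (IntPartition × IntPartition × IntPartition) :=
  {π | π.1.2.parts.Nodup}

/-- The size `|π| = |π₁| + |π₂| + |π₃|` of a triple of partitions. -/
def size (π : IntPartition × IntPartition × IntPartition) : ℕ := π.1.1 + π.2.1.1 + π.2.2.1

/-- The set `S` of vector partitions `(π₁, π₂, π₃)` with `1 ≤ s(π₁) < ∞` and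
`s(π₁) ≤ min (s(π₂), s(π₃))`. -/
def sPartitions : Set (IntPartition × IntPartition × IntPartition) :=
  {π | π ∈ vectorPartitions ∧ (1 ≤ smallestPart π.1 ∧ smallestPart π.1 < ⊤) ∧
    smallestPart π.1 ≤ min (smallestPart π.2.1) (smallestPart π.2.2)}

/-- The weight `ω₁(π) = (-1) ^ (#(π₁) - 1)`; on `S` the partition `π₁` has at least one part. -/
def weight (π : IntPartition × IntPartition × IntPartition) : ℤ := (-1) ^ (numParts π.1 - 1)

/-- The map `(π₁, π₂, π₃) ↦ (π₁, π₃, π₂)` as a map `S → S`. -/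
def conjugate (π : sPartitions) : sPartitions :=
  ⟨(π.1.1, π.1.2.2, π.1.2.1), π.2.1, π.2.2.1, by rw [min_comm]; exact π.2.2.2⟩

/-- The self-conjugate `S`-partitions of size `n`: the fixed points of `conjugate`. -/
def selfConjugate (n : ℕ) : Set sPartitions := {π | size π.1 = n ∧ conjugate π = π}

theorem finite_selfConjugate (n : ℕ) : (selfConjugate n).Finite := by
  have hI : {p : IntPartition | p.1 ≤ n}.Finite := by
    have h : (Set.range fun x : (Σ k : Fin (n + 1), (k : ℕ).Partition) =>
        (⟨x.1, x.2⟩ : IntPartition)).Finite := Set.finite_range _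
    refine h.subset ?_
    rintro ⟨k, p⟩ hk
    exact ⟨⟨⟨k, Nat.lt_succ_of_le hk⟩, p⟩, rfl⟩
  refine Set.Finite.subset
    (Set.Finite.preimage Subtype.val_injective.injOn (hI.prod (hI.prod hI))) ?_
  rintro ⟨π, hπ⟩ ⟨h, -⟩
  simp only [size] at h
  simp only [Set.mem_preimage, Set.mem_prod, Set.mem_ofPred_eq]
  omega

/-- `N_SC(n)`: the number of self-conjugate `S`-partitions of `n`, counted with the weight `ω₁`. -/
noncomputable def nSC (n : ℕ) : ℤ := ∑ π ∈ (finite_selfConjugate n).toFinset, weight π.1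

end QSeries

/-!
Write `a_n = (q; q)_n`, `e_n = (-q; q)_n` and `c = a_∞ / e_∞`.

A self-conjugate `S`-partition is a triple `(π₁, π₂, π₂)`. If `n` is the smallest part of `π₁`, the
remaining parts of `π₁` form a finite set of integers `> n`, and `π₂` is a multiset of integers
`≥ n`, every part of which counts twice. Hence `∑ N_SC(n) q ^ n` equals
`∑ q ^ n (q ^ (n + 1); q)_∞ / (q ^ (2 n); q ^ 2)_∞ = e_∞⁻¹ ∑ e_{n-1} q ^ n / (1 - q ^ n)`
(`hasSum_nSC_mul_pow`).

Since `e_n = e_{n-1} (1 + q ^ n)` and `∑ q ^ n e_{n-1} / a_n` telescopes to `(1 / c - 1) / 2`, the claim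
becomes
`∑ e_{n-1} q ^ n / (1 - q ^ n) * (1 / a_n - 1) =
  1 / 2 * ∑ q ^ (n (n + 1) / 2) / ((1 - q ^ n) a_n) * (e_n / a_n - 1)`
(`tsum_inv_sub_one_eq_tsum_div_sub_one`). Here `1 / a_n - 1` and `e_n / a_n - 1` are telescoping sums
over `k ≥ 1` of the differences, at `b = q ^ k` and `b = q ^ (k + 1)`, of `1 / (b; q)_n` and
`(-b; q)_n / (b; q)_n`. The factor `1 - q ^ n` cancels, and after interchanging the summations it
remains to show for each `k` that
`∑ e_{n-1} q ^ n / a_{n+k} = ∑ q ^ (n (n + 1) / 2) e_{k+n-1} / (e_k a_n a_{n+k})`.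
This is an instance of Jackson's transformation, obtained by iterating Fine's functional equation
for `F(a, b; t)`, which sends `(b, t)` to `(b q, t q)` (`tsum_fine_transformation`).
-/

open Filter Topology

namespace QSeries

/-! ### Finite and infinite `q`-shifted factorials -/

theorem qPoch_zero (A q : ℂ) : qPoch A q 0 = 1 := by simp [qPoch]

theorem qPoch_self_succ (q : ℂ) (n : ℕ) :
    qPoch q q (n + 1) = qPoch q q n * (1 - q ^ (n + 1)) := by
  rw [qPoch, Finset.prod_range_succ, ← qPoch, pow_succ']

theorem qPoch_neg_succ (q : ℂ) (n : ℕ) :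
    qPoch (-q) q (n + 1) = qPoch (-q) q n * (1 + q ^ (n + 1)) := by
  rw [qPoch, Finset.prod_range_succ, ← qPoch, pow_succ', neg_mul, sub_neg_eq_add]

theorem one_sub_pow_ne_zero {q : ℂ} (hq : ‖q‖ < 1) (n : ℕ) : 1 - q ^ (n + 1) ≠ 0 := by
  intro h
  have h2 : ‖q‖ ^ (n + 1) = 1 := by rw [← norm_pow, ← sub_eq_zero.1 h]; simp
  exact (pow_lt_one₀ (norm_nonneg q) hq n.succ_ne_zero).ne h2

theorem one_add_pow_ne_zero {q : ℂ} (hq : ‖q‖ < 1) (n : ℕ) : 1 + q ^ (n + 1) ≠ 0 := by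
  intro h
  have h2 : ‖q‖ ^ (n + 1) = 1 := by
    rw [← norm_pow, eq_neg_of_add_eq_zero_right h]; simp
  exact (pow_lt_one₀ (norm_nonneg q) hq n.succ_ne_zero).ne h2

theorem qPoch_self_ne_zero {q : ℂ} (hq : ‖q‖ < 1) (n : ℕ) : qPoch q q n ≠ 0 := by
  induction n with
  | zero => simp [qPoch_zero]
  | succ n ih => rw [qPoch_self_succ]; exact mul_ne_zero ih (one_sub_pow_ne_zero hq n)

theorem qPoch_neg_ne_zero {q : ℂ} (hq : ‖q‖ < 1) (n : ℕ) : qPoch (-q) q n ≠ 0 := by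
  induction n with
  | zero => simp [qPoch_zero]
  | succ n ih => rw [qPoch_neg_succ]; exact mul_ne_zero ih (one_add_pow_ne_zero hq n)

theorem qPochInf_self_ne_zero {q : ℂ} (hq : ‖q‖ < 1) : qPochInf q q ≠ 0 := by
  have hs := summable_norm_neg_mul_pow q hq
  have h := (multipliable_one_add_of_summable hs).tendsto_prod_tprod_nat
  have h0 : ∏' k : ℕ, (1 + -(q * q ^ k)) ≠ 0 := by
    refine tprod_one_add_ne_zero_of_summable (fun k hk => ?_) hs
    exact one_sub_pow_ne_zero hq k (by linear_combination hk)
  simp only [← sub_eq_add_neg] at h h0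
  rwa [tendsto_nhds_unique (tendsto_qPoch q hq) h]

theorem exists_norm_le_of_tendsto {u : ℕ → ℂ} {l : ℂ} (h : Tendsto u atTop (𝓝 l)) :
    ∃ C : ℝ, 0 < C ∧ ∀ n, ‖u n‖ ≤ C := by
  obtain ⟨C, hC⟩ := (Metric.isBounded_range_of_tendsto u h).exists_norm_le
  refine ⟨max C 1, by positivity, fun n => (hC _ ⟨n, rfl⟩).trans (le_max_left _ _)⟩

/-- Both `(q; q)_n` and `(-q; q)_n`, as well as their inverses, are bounded uniformly in `n`,
because they converge to nonzero limits. -/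
theorem exists_qPoch_bound {q : ℂ} (hq : ‖q‖ < 1) : ∃ C : ℝ, 0 < C ∧
    ∀ n, ‖qPoch q q n‖ ≤ C ∧ ‖(qPoch q q n)⁻¹‖ ≤ C ∧
      ‖qPoch (-q) q n‖ ≤ C ∧ ‖(qPoch (-q) q n)⁻¹‖ ≤ C := by
  have ha := tendsto_qPoch q hq
  have he := tendsto_qPoch (-q) hq
  obtain ⟨C₁, h₁, H₁⟩ := exists_norm_le_of_tendsto ha
  obtain ⟨C₂, h₂, H₂⟩ := exists_norm_le_of_tendsto (ha.inv₀ (qPochInf_self_ne_zero hq))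
  obtain ⟨C₃, h₃, H₃⟩ := exists_norm_le_of_tendsto he
  obtain ⟨C₄, h₄, H₄⟩ := exists_norm_le_of_tendsto (he.inv₀ (qPochInf_neg_ne_zero hq))
  refine ⟨C₁ + C₂ + C₃ + C₄, by positivity, fun n => ?_⟩
  have := H₁ n
  have := H₂ n
  have := H₃ n
  have := H₄ n
  refine ⟨?_, ?_, ?_, ?_⟩ <;> linarith

theorem summable_of_norm_le_mul_pow {q : ℂ} (hq : ‖q‖ < 1) {u : ℕ → ℂ} (C : ℝ)
    (h : ∀ n, ‖u n‖ ≤ C * ‖q‖ ^ n) : Summable u :=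
  .of_norm_bounded ((summable_geometric_of_lt_one (norm_nonneg q) hq).mul_left C) h

theorem norm_pow_le_pow_of_le {q : ℂ} (hq : ‖q‖ < 1) {m n : ℕ} (h : n ≤ m) :
    ‖q ^ m‖ ≤ ‖q‖ ^ n := by
  rw [norm_pow]
  exact pow_le_pow_of_le_one (norm_nonneg q) hq.le h

theorem le_triangular (m : ℕ) : m + 1 ≤ (m + 1) * (m + 2) / 2 := by
  rw [Nat.le_div_iff_mul_le two_pos]
  gcongr
  omega

theorem triangular_succ (m : ℕ) :
    (m + 1 + 1) * (m + 1 + 2) / 2 = (m + 1) * (m + 2) / 2 + (m + 2) := by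
  rw [show (m + 1 + 1) * (m + 1 + 2) = (m + 1) * (m + 2) + (m + 2) * 2 by ring,
    Nat.add_mul_div_right _ _ two_pos]

theorem hasSum_of_telescoping {u g : ℕ → ℂ} {l : ℂ} (hu : Summable u)
    (h : ∀ n, u n = g n - g (n + 1)) (hg : Tendsto g atTop (𝓝 l)) : HasSum u (g 0 - l) := by
  have h1 := hu.hasSum.tendsto_sum_nat
  have h2 : Tendsto (fun N => ∑ n ∈ Finset.range N, u n) atTop (𝓝 (g 0 - l)) := by
    simp only [h, Finset.sum_range_sub']
    exact tendsto_const_nhds.sub hg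
  rw [← tendsto_nhds_unique h1 h2]
  exact hu.hasSum

/-! ### An iterated functional equation of Fine -/

/-- The summand of `F(-1, q ^ (k + 1 + j); q ^ (j + 1)) / (q; q)_{k + 1 + j}`, where
`F(a, b; t) = ∑ (a q)_m t ^ m / (b q)_m` is Fine's function. -/
noncomputable def fineTerm (q : ℂ) (k j m : ℕ) : ℂ :=
  qPoch (-q) q m * q ^ ((j + 1) * m) / qPoch q q (k + 1 + j + m)

/-- The factor that `j` applications of the functional equation put in front of Fine's function,
when it starts with the factor `q` for `j = 0`. -/
noncomputable def fineCoeff (q : ℂ) (k j : ℕ) : ℂ :=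
  q ^ ((j + 1) * (j + 2) / 2) * qPoch (-q) q (k + j) / (qPoch (-q) q k * qPoch q q j)

theorem exists_fineTerm_bound {q : ℂ} (hq : ‖q‖ < 1) :
    ∃ C : ℝ, 0 < C ∧ ∀ k j m, ‖fineTerm q k j m‖ ≤ C * ‖q‖ ^ m := by
  obtain ⟨C, hC, H⟩ := exists_qPoch_bound hq
  refine ⟨C * C, by positivity, fun k j m => ?_⟩
  have h1 : ‖q ^ ((j + 1) * m)‖ ≤ ‖q‖ ^ m := norm_pow_le_pow_of_le hq (by nlinarith)
  rw [fineTerm, div_eq_mul_inv, norm_mul, norm_mul]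
  calc _ ≤ C * ‖q‖ ^ m * C := by
        gcongr
        · exact (H m).2.2.1
        · exact (H _).2.1
    _ = _ := by ring

theorem summable_fineTerm {q : ℂ} (hq : ‖q‖ < 1) (k j : ℕ) : Summable (fineTerm q k j) := by
  obtain ⟨C, -, H⟩ := exists_fineTerm_bound hq
  exact summable_of_norm_le_mul_pow hq C (H k j)

/-- Fine's functional equation
`(1 - t) F(a, b; t) = 1 + (b - a) t q / (1 - b q) * F(a, b q; t q)`, at `a = -1`,
`b = q ^ (k + 1 + j)` and `t = q ^ (j + 1)`. -/
theorem fine_functional_equation {q : ℂ} (hq : ‖q‖ < 1) (k j : ℕ) :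
    (1 - q ^ (j + 1)) * ∑' m, fineTerm q k j m = (qPoch q q (k + 1 + j))⁻¹ +
      (1 + q ^ (k + j + 1)) * q ^ (j + 2) * ∑' m, fineTerm q k (j + 1) m := by
  have hs := summable_fineTerm hq k j
  have key : ∀ m, fineTerm q k j (m + 1) - q ^ (j + 1) * fineTerm q k j m =
      (1 + q ^ (k + j + 1)) * q ^ (j + 2) * fineTerm q k (j + 1) m := by
    intro m
    have h1 := qPoch_self_ne_zero hq (k + 1 + j + m)
    have h2 := one_sub_pow_ne_zero hq (k + 1 + j + m)
    have e : k + 1 + (j + 1) + m = k + 1 + j + m + 1 := by ring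
    simp only [fineTerm]
    rw [e, ← add_assoc (k + 1 + j) m 1, qPoch_self_succ, qPoch_neg_succ]
    field_simp
    ring
  have h0 : fineTerm q k j 0 = (qPoch q q (k + 1 + j))⁻¹ := by simp [fineTerm, qPoch_zero]
  have h1 := hs.tsum_eq_zero_add
  have h2 := ((summable_nat_add_iff 1).2 hs).tsum_sub (hs.mul_left (q ^ (j + 1)))
  simp only [key, tsum_mul_left] at h2
  rw [h0] at h1
  linear_combination h1 - h2

theorem exists_fineCoeff_bound {q : ℂ} (hq : ‖q‖ < 1) :
    ∃ C : ℝ, 0 < C ∧ ∀ k j, ‖fineCoeff q k j‖ ≤ C * ‖q‖ ^ j := by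
  obtain ⟨C, hC, H⟩ := exists_qPoch_bound hq
  refine ⟨C * C * C, by positivity, fun k j => ?_⟩
  have h1 : ‖q ^ ((j + 1) * (j + 2) / 2)‖ ≤ ‖q‖ ^ j :=
    norm_pow_le_pow_of_le hq (by have := le_triangular j; omega)
  rw [fineCoeff, div_eq_mul_inv, mul_inv, norm_mul, norm_mul, norm_mul]
  calc _ ≤ ‖q‖ ^ j * C * (C * C) := by
        gcongr
        · exact (H _).2.2.1
        · exact (H _).2.2.2
        · exact (H _).2.1
    _ = _ := by ring

/-- The transformation obtained by iterating Fine's functional equation indefinitely; it is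
Jackson's transformation of a `₂φ₁` series into a `₂φ₂` series, with numerator parameters `-q`
and `q`. -/
theorem tsum_fine_transformation {q : ℂ} (hq : ‖q‖ < 1) (k : ℕ) :
    ∑' m, qPoch (-q) q m * q ^ (m + 1) / qPoch q q (m + 1 + k) =
      ∑' m, q ^ ((m + 1) * (m + 2) / 2) * qPoch (-q) q (k + m) /
        (qPoch (-q) q k * qPoch q q (m + 1) * qPoch q q (m + 1 + k)) := by
  obtain ⟨C, hC, H⟩ := exists_qPoch_bound hq
  obtain ⟨C₁, hC₁, H₁⟩ := exists_fineTerm_bound hq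
  obtain ⟨C₂, hC₂, H₂⟩ := exists_fineCoeff_bound hq
  set g : ℕ → ℂ := fun j => fineCoeff q k j * ∑' m, fineTerm q k j m
  have hg : Tendsto g atTop (𝓝 0) := by
    have hV : ∀ j, ‖∑' m, fineTerm q k j m‖ ≤ C₁ * (1 - ‖q‖)⁻¹ := fun j =>
      tsum_of_norm_bounded ((hasSum_geometric_of_lt_one (norm_nonneg q) hq).mul_left C₁) (H₁ k j)
    refine squeeze_zero_norm (a := fun j => C₂ * (C₁ * (1 - ‖q‖)⁻¹) * ‖q‖ ^ j) (fun j => ?_) ?_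
    · rw [norm_mul]
      calc _ ≤ C₂ * ‖q‖ ^ j * (C₁ * (1 - ‖q‖)⁻¹) := by
            gcongr
            · exact H₂ k j
            · exact hV j
        _ = _ := by ring
    · simpa using (tendsto_pow_atTop_nhds_zero_of_lt_one (norm_nonneg q) hq).const_mul
        (C₂ * (C₁ * (1 - ‖q‖)⁻¹))
  have hu : Summable fun m => q ^ ((m + 1) * (m + 2) / 2) * qPoch (-q) q (k + m) /
        (qPoch (-q) q k * qPoch q q (m + 1) * qPoch q q (m + 1 + k)) := by
    refine summable_of_norm_le_mul_pow hq (C * C * C * C) fun m => ?_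
    have h1 : ‖q ^ ((m + 1) * (m + 2) / 2)‖ ≤ ‖q‖ ^ m :=
      norm_pow_le_pow_of_le hq (by have := le_triangular m; omega)
    rw [div_eq_mul_inv, mul_inv, mul_inv, norm_mul, norm_mul, norm_mul, norm_mul]
    calc _ ≤ ‖q‖ ^ m * C * (C * C * C) := by
          gcongr
          · exact (H _).2.2.1
          · exact (H _).2.2.2
          · exact (H _).2.1
          · exact (H _).2.1
      _ = _ := by ring
  have hsum := hasSum_of_telescoping hu (g := g) (fun j => ?_) hg
  · rw [hsum.tsum_eq, sub_zero]
    simp only [g]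
    rw [← tsum_mul_left]
    refine tsum_congr fun m => ?_
    have := qPoch_neg_ne_zero hq k
    simp only [fineCoeff, fineTerm, qPoch_zero]
    rw [show k + 1 + 0 + m = m + 1 + k by ring]
    field_simp
    simp
    ring
  · have hf := fine_functional_equation hq k j
    have h1 := qPoch_neg_ne_zero hq k
    have h2 := qPoch_self_ne_zero hq j
    have h3 := one_sub_pow_ne_zero hq j
    have h4 := qPoch_self_ne_zero hq (j + 1 + k)
    have hV : ∑' m, fineTerm q k j m = ((qPoch q q (k + 1 + j))⁻¹ +
      (1 + q ^ (k + j + 1)) * q ^ (j + 2) * ∑' m, fineTerm q k (j + 1) m) / (1 - q ^ (j + 1)) := by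
      rw [← hf]; field_simp
    simp only [g]
    rw [hV]
    simp only [fineCoeff]
    rw [triangular_succ, ← add_assoc k j 1, qPoch_neg_succ, qPoch_self_succ,
      show k + 1 + j = j + 1 + k by ring, pow_add q _ (j + 2)]
    field_simp
    ring


/-! ### Two double series -/

theorem hasSum_inv_qPoch_sub_one {q : ℂ} (hq : ‖q‖ < 1) (m : ℕ) :
    HasSum (fun k => qPoch q q k * q ^ (k + 1) / qPoch q q (m + 1 + (k + 1)))
      (((qPoch q q (m + 1))⁻¹ - 1) / (1 - q ^ (m + 1))) := by
  obtain ⟨C, hC, H⟩ := exists_qPoch_bound hq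
  have hm := one_sub_pow_ne_zero hq m
  have hlim : Tendsto (fun k => qPoch q q k / qPoch q q (m + 1 + k) / (1 - q ^ (m + 1))) atTop
      (𝓝 (1 / (1 - q ^ (m + 1)))) := by
    refine Tendsto.div_const ?_ _
    have h1 := tendsto_qPoch q hq
    have h2 := (tendsto_add_atTop_iff_nat (m + 1)).2 h1
    have h3 := h1.div h2 (qPochInf_self_ne_zero hq)
    rw [div_self (qPochInf_self_ne_zero hq)] at h3
    simpa only [Pi.div_def, add_comm (m + 1)] using h3
  have hs : Summable fun k => qPoch q q k * q ^ (k + 1) / qPoch q q (m + 1 + (k + 1)) := by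
    refine summable_of_norm_le_mul_pow hq (C * C) fun k => ?_
    rw [div_eq_mul_inv, norm_mul, norm_mul]
    calc _ ≤ C * ‖q‖ ^ k * C := by
          gcongr
          · exact (H _).1
          · exact norm_pow_le_pow_of_le hq (by omega)
          · exact (H _).2.1
      _ = _ := by ring
  convert hasSum_of_telescoping hs (fun k => ?_) hlim using 1
  · simp only [qPoch_zero, add_zero]; ring
  · have h1 := qPoch_self_ne_zero hq (m + 1 + k)
    have h2 := one_sub_pow_ne_zero hq (m + 1 + k)
    rw [← add_assoc (m + 1) k 1, qPoch_self_succ q (m + 1 + k), qPoch_self_succ q k]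
    field_simp
    ring

theorem hasSum_qPoch_neg_div_sub_one {q : ℂ} (hq : ‖q‖ < 1) (m : ℕ) :
    HasSum (fun k => qPoch q q k * q ^ (k + 1) * qPoch (-q) q (k + 1 + m) /
        (qPoch (-q) q (k + 1) * qPoch q q (m + 1 + (k + 1))))
      ((qPoch (-q) q (m + 1) / qPoch q q (m + 1) - 1) / (2 * (1 - q ^ (m + 1)))) := by
  obtain ⟨C, hC, H⟩ := exists_qPoch_bound hq
  have hm := one_sub_pow_ne_zero hq m
  have hlim : Tendsto (fun k => qPoch q q k / qPoch q q (m + 1 + k) *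
      (qPoch (-q) q (m + 1 + k) / qPoch (-q) q k) / (2 * (1 - q ^ (m + 1)))) atTop
      (𝓝 (1 / (2 * (1 - q ^ (m + 1))))) := by
    refine Tendsto.div_const ?_ _
    have h1 := tendsto_qPoch q hq
    have h2 := (tendsto_add_atTop_iff_nat (m + 1)).2 h1
    have h3 := h1.div h2 (qPochInf_self_ne_zero hq)
    rw [div_self (qPochInf_self_ne_zero hq)] at h3
    have h4 := tendsto_qPoch (-q) hq
    have h5 := (tendsto_add_atTop_iff_nat (m + 1)).2 h4
    have h6 := h5.div h4 (qPochInf_neg_ne_zero hq)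
    rw [div_self (qPochInf_neg_ne_zero hq)] at h6
    simpa only [Pi.div_def, add_comm (m + 1), mul_one] using h3.mul h6
  have hs : Summable fun k => qPoch q q k * q ^ (k + 1) * qPoch (-q) q (k + 1 + m) /
        (qPoch (-q) q (k + 1) * qPoch q q (m + 1 + (k + 1))) := by
    refine summable_of_norm_le_mul_pow hq (C * C * C * C) fun k => ?_
    rw [div_eq_mul_inv, mul_inv, norm_mul, norm_mul, norm_mul, norm_mul]
    calc _ ≤ C * ‖q‖ ^ k * C * (C * C) := by
          gcongr
          · exact (H _).1
          · exact norm_pow_le_pow_of_le hq (by omega)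
          · exact (H _).2.2.1
          · exact (H _).2.2.2
          · exact (H _).2.1
      _ = _ := by ring
  convert hasSum_of_telescoping hs (fun k => ?_) hlim using 1
  · simp only [qPoch_zero, add_zero]; field_simp
  · have h1 := qPoch_self_ne_zero hq (m + 1 + k)
    have h2 := one_sub_pow_ne_zero hq (m + 1 + k)
    have h3 := qPoch_neg_ne_zero hq k
    have h4 := one_add_pow_ne_zero hq k
    rw [← add_assoc (m + 1) k 1, qPoch_self_succ q (m + 1 + k), qPoch_self_succ q k,
      show k + 1 + m = m + 1 + k by ring, qPoch_neg_succ q (m + 1 + k), qPoch_neg_succ q k]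
    field_simp
    ring

theorem summable_uncurry_of_norm_le {q : ℂ} (hq : ‖q‖ < 1) {u : ℕ → ℕ → ℂ} (C : ℝ)
    (h : ∀ m k, ‖u m k‖ ≤ C * (‖q‖ ^ m * ‖q‖ ^ k)) : Summable (Function.uncurry u) := by
  have hg := summable_geometric_of_lt_one (norm_nonneg q) hq
  have hp := hg.mul_of_nonneg hg (fun _ => by positivity) (fun _ => by positivity)
  exact .of_norm_bounded (hp.mul_left C) fun x => h x.1 x.2

/-- The core of the argument. Both `1 / (q; q)_n - 1` and `(-q; q)_n / (q; q)_n - 1` expand into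
telescoping series over `k`, and for fixed `k` the sums over `n` agree by Fine's transformation. -/
theorem tsum_inv_sub_one_eq_tsum_div_sub_one {q : ℂ} (hq : ‖q‖ < 1) :
    (∑' m, qPoch (-q) q m * q ^ (m + 1) / (1 - q ^ (m + 1)) * ((qPoch q q (m + 1))⁻¹ - 1)) =
      1 / 2 * ∑' m, q ^ ((m + 1) * (m + 2) / 2) / ((1 - q ^ (m + 1)) * qPoch q q (m + 1)) *
        (qPoch (-q) q (m + 1) / qPoch q q (m + 1) - 1) := by
  obtain ⟨C, hC, H⟩ := exists_qPoch_bound hq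
  set G : ℕ → ℕ → ℂ := fun m k => qPoch (-q) q m * q ^ (m + 1) *
    (qPoch q q k * q ^ (k + 1) / qPoch q q (m + 1 + (k + 1))) with hG
  set R : ℕ → ℕ → ℂ := fun m k => q ^ ((m + 1) * (m + 2) / 2) / qPoch q q (m + 1) *
    (qPoch q q k * q ^ (k + 1) * qPoch (-q) q (k + 1 + m) /
        (qPoch (-q) q (k + 1) * qPoch q q (m + 1 + (k + 1)))) with hR
  have hGs : Summable (Function.uncurry G) := by
    refine summable_uncurry_of_norm_le hq (C * C * C) fun m k => ?_
    simp only [hG]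
    rw [div_eq_mul_inv, norm_mul, norm_mul, norm_mul, norm_mul]
    calc _ ≤ C * ‖q‖ ^ m * (C * ‖q‖ ^ k * C) := by
          gcongr
          · exact (H _).2.2.1
          · exact norm_pow_le_pow_of_le hq (by omega)
          · exact (H _).1
          · exact norm_pow_le_pow_of_le hq (by omega)
          · exact (H _).2.1
      _ = _ := by ring
  have hRs : Summable (Function.uncurry R) := by
    refine summable_uncurry_of_norm_le hq (C * C * C * C * C) fun m k => ?_
    simp only [hR]
    rw [div_eq_mul_inv, div_eq_mul_inv, mul_inv, norm_mul, norm_mul, norm_mul, norm_mul, norm_mul,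
      norm_mul]
    calc _ ≤ ‖q‖ ^ m * C * (C * ‖q‖ ^ k * C * (C * C)) := by
          gcongr
          · exact norm_pow_le_pow_of_le hq (by have := le_triangular m; omega)
          · exact (H _).2.1
          · exact (H _).1
          · exact norm_pow_le_pow_of_le hq (by omega)
          · exact (H _).2.2.1
          · exact (H _).2.2.2
          · exact (H _).2.1
      _ = _ := by ring
  have hGm : ∀ m, ∑' k, G m k =
      qPoch (-q) q m * q ^ (m + 1) / (1 - q ^ (m + 1)) * ((qPoch q q (m + 1))⁻¹ - 1) := by
    intro m
    simp only [hG]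
    rw [tsum_mul_left, (hasSum_inv_qPoch_sub_one hq m).tsum_eq]
    ring
  have hRm : ∀ m, ∑' k, R m k =
      1 / 2 * (q ^ ((m + 1) * (m + 2) / 2) / ((1 - q ^ (m + 1)) * qPoch q q (m + 1)) *
        (qPoch (-q) q (m + 1) / qPoch q q (m + 1) - 1)) := by
    intro m
    simp only [hR]
    rw [tsum_mul_left, (hasSum_qPoch_neg_div_sub_one hq m).tsum_eq]
    have := one_sub_pow_ne_zero hq m
    have := qPoch_self_ne_zero hq (m + 1)
    field_simp
  rw [← tsum_mul_left]
  simp only [← hGm, ← hRm]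
  rw [← hGs.tsum_comm, ← hRs.tsum_comm]
  refine tsum_congr fun k => ?_
  have hF := congrArg (fun z => qPoch q q k * q ^ (k + 1) * z) (tsum_fine_transformation hq (k + 1))
  simp only [← tsum_mul_left] at hF
  refine (tsum_congr fun m => ?_).trans (hF.trans (tsum_congr fun m => ?_))
  · simp only [hG]; ring
  · simp only [hR]; ring

/-! ### Reduction to the series of the self-conjugate `S`-partitions -/

theorem exists_inv_one_sub_pow_bound {q : ℂ} (hq : ‖q‖ < 1) :
    ∃ C : ℝ, 0 < C ∧ ∀ n, ‖(1 - q ^ (n + 1))⁻¹‖ ≤ C := by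
  refine ⟨(1 - ‖q‖)⁻¹, by simpa using hq, fun n => ?_⟩
  rw [norm_inv]
  have h1 : ‖q ^ (n + 1)‖ ≤ ‖q‖ := by simpa using norm_pow_le_pow_of_le hq (Nat.le_add_left 1 n)
  have h2 := norm_sub_norm_le 1 (q ^ (n + 1))
  rw [norm_one] at h2
  exact inv_anti₀ (by linarith) (by linarith)

theorem summable_qPoch_neg_mul_pow_div {q : ℂ} (hq : ‖q‖ < 1) :
    Summable fun m => qPoch (-q) q m * q ^ (m + 1) / (1 - q ^ (m + 1)) := by
  obtain ⟨C, hC, H⟩ := exists_qPoch_bound hq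
  obtain ⟨D, hD, H'⟩ := exists_inv_one_sub_pow_bound hq
  refine summable_of_norm_le_mul_pow hq (C * D) fun m => ?_
  rw [div_eq_mul_inv, norm_mul, norm_mul]
  calc _ ≤ C * ‖q‖ ^ m * D := by
        gcongr
        · exact (H _).2.2.1
        · exact norm_pow_le_pow_of_le hq (by omega)
        · exact H' m
    _ = _ := by ring

theorem summable_qPoch_neg_mul_pow_div_mul_inv {q : ℂ} (hq : ‖q‖ < 1) :
    Summable fun m => qPoch (-q) q m * q ^ (m + 1) / (1 - q ^ (m + 1)) *
      (qPoch q q (m + 1))⁻¹ := by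
  obtain ⟨C, hC, H⟩ := exists_qPoch_bound hq
  obtain ⟨D, hD, H'⟩ := exists_inv_one_sub_pow_bound hq
  refine summable_of_norm_le_mul_pow hq (C * D * C) fun m => ?_
  rw [div_eq_mul_inv, norm_mul, norm_mul, norm_mul]
  calc _ ≤ C * ‖q‖ ^ m * D * C := by
        gcongr
        · exact (H _).2.2.1
        · exact norm_pow_le_pow_of_le hq (by omega)
        · exact H' m
        · exact (H _).2.1
    _ = _ := by ring

theorem summable_pow_triangular_div {q : ℂ} (hq : ‖q‖ < 1) :
    Summable fun m => q ^ ((m + 1) * (m + 2) / 2) / ((1 - q ^ (m + 1)) * qPoch q q (m + 1)) *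
        (qPoch (-q) q (m + 1) / qPoch q q (m + 1) - 1) := by
  obtain ⟨C, hC, H⟩ := exists_qPoch_bound hq
  obtain ⟨D, hD, H'⟩ := exists_inv_one_sub_pow_bound hq
  refine summable_of_norm_le_mul_pow hq (D * C * (C * C + 1)) fun m => ?_
  have h : ‖qPoch (-q) q (m + 1) / qPoch q q (m + 1) - 1‖ ≤ C * C + 1 := by
    refine (norm_sub_le _ _).trans ?_
    rw [div_eq_mul_inv, norm_mul, norm_one]
    gcongr
    · exact (H _).2.2.1
    · exact (H _).2.1
  rw [div_eq_mul_inv, mul_inv, norm_mul, norm_mul, norm_mul]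
  calc _ ≤ ‖q‖ ^ m * (D * C) * (C * C + 1) := by
        gcongr
        · exact norm_pow_le_pow_of_le hq (by have := le_triangular m; omega)
        · exact H' m
        · exact (H _).2.1
    _ = _ := by ring

/-- The telescoping series `∑ 2 q ^ n (-q; q)_{n - 1} / (q; q)_n = (-q; q)_∞ / (q; q)_∞ - 1`. -/
theorem hasSum_qPoch_neg_div_qPoch_self {q : ℂ} (hq : ‖q‖ < 1) :
    HasSum (fun m => qPoch (-q) q m * q ^ (m + 1) * (qPoch q q (m + 1))⁻¹)
      (1 / 2 * (qPochInf (-q) q / qPochInf q q - 1)) := by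
  obtain ⟨C, hC, H⟩ := exists_qPoch_bound hq
  have hs : Summable fun m => qPoch (-q) q m * q ^ (m + 1) * (qPoch q q (m + 1))⁻¹ := by
    refine summable_of_norm_le_mul_pow hq (C * C) fun m => ?_
    rw [norm_mul, norm_mul]
    calc _ ≤ C * ‖q‖ ^ m * C := by
          gcongr
          · exact (H _).2.2.1
          · exact norm_pow_le_pow_of_le hq (by omega)
          · exact (H _).2.1
      _ = _ := by ring
  -- The terms are `g m - g (m + 1)` for `g m = -(-q; q)_m / (2 (q; q)_m)`.
  have hlim := (((tendsto_qPoch (-q) hq).div (tendsto_qPoch q hq)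
    (qPochInf_self_ne_zero hq)).const_mul (-1 / 2 : ℂ))
  convert hasSum_of_telescoping hs (fun m => ?_) hlim using 1
  · simp only [Pi.div_apply, qPoch_zero]; ring
  · have h1 := qPoch_self_ne_zero hq m
    have h2 := one_sub_pow_ne_zero hq m
    simp only [Pi.div_apply]
    rw [qPoch_self_succ, qPoch_neg_succ]
    field_simp
    ring

/-- Writing `(-q; q)_n = (-q; q)_{n - 1} (1 + q ^ n)` and
`(1 + q ^ n) / (1 - q ^ n) = 2 / (1 - q ^ n) - 1` splits the series into two known ones. -/
theorem hasSum_qPoch_neg_div_mul_pow_div {q : ℂ} (hq : ‖q‖ < 1) :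
    HasSum (fun m => qPoch (-q) q (m + 1) / qPoch q q (m + 1) *
        (q ^ (m + 1) / (1 - q ^ (m + 1))))
      (2 * (∑' m, qPoch (-q) q m * q ^ (m + 1) / (1 - q ^ (m + 1)) * (qPoch q q (m + 1))⁻¹) -
        1 / 2 * (qPochInf (-q) q / qPochInf q q - 1)) := by
  refine (((summable_qPoch_neg_mul_pow_div_mul_inv hq).hasSum.mul_left 2).sub
    (hasSum_qPoch_neg_div_qPoch_self hq)).congr_fun fun m => ?_
  have h1 := qPoch_self_ne_zero hq (m + 1)
  have h2 := one_sub_pow_ne_zero hq m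
  rw [qPoch_neg_succ]
  field_simp
  ring

/-- The analytic identity, with the generating function of the self-conjugate `S`-partitions
replaced by its closed form. -/
theorem qPoch_series_identity {q : ℂ} (hq : ‖q‖ < 1) :
    qPochInf q q * ((qPochInf (-q) q)⁻¹ *
        ∑' m, qPoch (-q) q m * q ^ (m + 1) / (1 - q ^ (m + 1))) +
      1 / 2 * (qPochInf q q / qPochInf (-q) q) *
        ∑' m : ℕ, q ^ ((m + 1) * (m + 2) / 2) / ((1 - q ^ (m + 1)) * qPoch q q (m + 1)) *
            (qPoch (-q) q (m + 1) / qPoch q q (m + 1) - 1) =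
    1 / 4 - 1 / 4 * (qPochInf q q / qPochInf (-q) q) +
      1 / 2 * (qPochInf q q / qPochInf (-q) q) *
        ∑' m : ℕ, qPoch (-q) q (m + 1) / qPoch q q (m + 1) *
            (q ^ (m + 1) / (1 - q ^ (m + 1))) := by
  have h := tsum_inv_sub_one_eq_tsum_div_sub_one hq
  simp only [mul_sub, mul_one] at h
  rw [(summable_qPoch_neg_mul_pow_div_mul_inv hq).tsum_sub (summable_qPoch_neg_mul_pow_div hq)] at h
  simp only [← mul_sub_one] at h
  rw [(hasSum_qPoch_neg_div_mul_pow_div hq).tsum_eq, mul_assoc (1 / 2 : ℂ), mul_left_comm (1 / 2 : ℂ),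
    ← h]
  have h1 := qPochInf_self_ne_zero hq
  have h2 := qPochInf_neg_ne_zero hq
  field_simp
  ring


/-! ### Generating functions of finite sets and of multisets -/

/-- The generating function of the finite sets of integers `> n`, signed by their cardinality. -/
theorem tsum_finset_prod_eq {q : ℂ} (hq : ‖q‖ < 1) (n : ℕ) :
    ∑' t : Finset ℕ, ∏ i ∈ t, (if n < i then -q ^ i else 0) = qPochInf q q / qPoch q q n := by
  have hs : Summable fun i : ℕ => ‖if n < i then -q ^ i else 0‖ := by
    refine (summable_geometric_of_lt_one (norm_nonneg q) hq).of_nonneg_of_le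
      (fun _ => norm_nonneg _) fun i => ?_
    split_ifs <;> simp
  rw [← tprod_one_add (summable_finsetProd_of_summable_norm hs)]
  have h1 := (multipliable_one_add_of_summable hs).tendsto_prod_tprod_nat
  have h2 : Tendsto (fun N => ∏ i ∈ Finset.range (N + (n + 1)), (1 + if n < i then -q ^ i else 0))
      atTop (𝓝 (qPochInf q q / qPoch q q n)) := by
    have h3 := ((tendsto_add_atTop_iff_nat n).2 (tendsto_qPoch q hq)).div_const (qPoch q q n)
    refine h3.congr fun N => ?_
    rw [div_eq_iff (qPoch_self_ne_zero hq n)]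
    induction N with
    | zero =>
      rw [Finset.prod_eq_one fun i hi => ?_]
      · simp
      · rw [if_neg (by simp at hi; omega), add_zero]
    | succ N ih =>
      rw [show N + 1 + n = N + n + 1 by ring, show N + 1 + (n + 1) = N + (n + 1) + 1 by ring,
        qPoch_self_succ, ih, Finset.prod_range_succ, if_pos (by omega)]
      ring
  exact tendsto_nhds_unique h1 ((tendsto_add_atTop_iff_nat (n + 1)).1 h2)

/-- A multiset, encoded as the finite set of the pairs of an element and its multiplicity. -/
def countGraph (m : Multiset ℕ) : Finset (ℕ × ℕ) := m.toFinset.image fun i => (i, m.count i)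

theorem countGraph_injective : Function.Injective countGraph := by
  intro m m' h
  have key : ∀ {m m' : Multiset ℕ}, countGraph m = countGraph m' → ∀ i ∈ m,
      m.count i = m'.count i := by
    intro m m' h i hi
    have : (i, m.count i) ∈ countGraph m' := by
      rw [← h]; exact Finset.mem_image_of_mem _ (Multiset.mem_toFinset.2 hi)
    obtain ⟨j, -, hj⟩ := Finset.mem_image.1 this
    obtain ⟨rfl, h2⟩ := Prod.mk.inj hj
    exact h2.symm
  ext i
  by_cases hi : i ∈ m
  · exact key h i hi
  · by_cases hi' : i ∈ m'
    · exact (key h.symm i hi').symm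
    · rw [Multiset.count_eq_zero.2 hi, Multiset.count_eq_zero.2 hi']

/-- The sum over the multisets of positive integers is part of the expansion of
`∏ (1 + r ^ (i * k))` over all `i, k ≥ 1`, which converges. -/
theorem summable_multiset_pow_sum {r : ℝ} (h0 : 0 ≤ r) (h1 : r < 1) :
    Summable fun m : Multiset ℕ => if ∀ i ∈ m, 0 < i then r ^ m.sum else 0 := by
  set w : ℕ × ℕ → ℝ := fun x => if 0 < x.1 ∧ 0 < x.2 then r ^ (x.1 * x.2) else 0 with hw
  have hw0 : ∀ x, 0 ≤ w x := fun x => by simp only [hw]; split_ifs <;> positivity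
  have hsw : Summable w := by
    have hg := summable_geometric_of_lt_one (Real.sqrt_nonneg r)
      ((Real.sqrt_lt_sqrt h0 h1).trans_eq Real.sqrt_one)
    have hp := hg.mul_of_nonneg hg (fun _ => by positivity) (fun _ => by positivity)
    refine hp.of_nonneg_of_le hw0 fun x => ?_
    simp only [hw]
    split_ifs with hx
    · rw [← pow_add]
      nth_rw 1 [← Real.sq_sqrt h0]
      rw [← pow_mul]
      refine pow_le_pow_of_le_one (Real.sqrt_nonneg r) (Real.sqrt_le_one.2 h1.le) ?_
      nlinarith [hx.1, hx.2]
    · positivity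
  have hs := (summable_finsetProd_of_summable_nonneg hw0 hsw).comp_injective countGraph_injective
  refine hs.congr fun m => ?_
  simp only [Function.comp_apply, countGraph]
  rw [Finset.prod_image fun i _ j _ h => (Prod.mk.inj h).1]
  split_ifs with hm
  · rw [Finset.sum_multiset_count, ← Finset.prod_pow_eq_pow_sum]
    refine Finset.prod_congr rfl fun i hi => ?_
    rw [Multiset.mem_toFinset] at hi
    simp only [hw]
    rw [if_pos ⟨hm i hi, Multiset.count_pos.2 hi⟩, smul_eq_mul, mul_comm]
  · push Not at hm
    obtain ⟨i, hi, hi0⟩ := hm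
    refine Finset.prod_eq_zero (Multiset.mem_toFinset.2 hi) ?_
    simp only [hw]
    rw [if_neg (by omega)]

theorem summable_norm_multiset_pow_sum {x : ℂ} (hx : ‖x‖ < 1) (n : ℕ) :
    Summable fun m : Multiset ℕ => ‖if ∀ i ∈ m, n < i then x ^ m.sum else 0‖ := by
  refine (summable_multiset_pow_sum (norm_nonneg x) hx).of_nonneg_of_le
    (fun _ => norm_nonneg _) fun m => ?_
  split_ifs with h1 h2 h2
  · rw [norm_pow]
  · exact absurd (fun i hi => Nat.zero_lt_of_lt (h1 i hi)) h2
  · simp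
  · simp

/-- Splitting off one part `n + 1`, if there is one. -/
theorem tsum_multiset_pow_sum_succ {x : ℂ} (hx : ‖x‖ < 1) (n : ℕ) :
    ∑' m : Multiset ℕ, (if ∀ i ∈ m, n + 1 < i then x ^ m.sum else 0) =
      (1 - x ^ (n + 1)) * ∑' m : Multiset ℕ, (if ∀ i ∈ m, n < i then x ^ m.sum else 0) := by
  have hs := (summable_norm_multiset_pow_sum hx n).of_norm
  have hs' := (summable_norm_multiset_pow_sum hx (n + 1)).of_norm
  have hinj : Function.Injective fun m : Multiset ℕ => (n + 1) ::ₘ m :=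
    fun _ _ h => (Multiset.cons_inj_right _).1 h
  have hsupp : Function.support (fun m : Multiset ℕ => (if ∀ i ∈ m, n < i then x ^ m.sum else 0) -
      (if ∀ i ∈ m, n + 1 < i then x ^ m.sum else 0)) ⊆
        Set.range fun m : Multiset ℕ => (n + 1) ::ₘ m := by
    intro m hm
    by_cases hmem : n + 1 ∈ m
    · obtain ⟨m', rfl⟩ := Multiset.exists_cons_of_mem hmem
      exact ⟨m', rfl⟩
    · refine absurd ?_ hm
      have : (∀ i ∈ m, n < i) ↔ ∀ i ∈ m, n + 1 < i :=
        forall₂_congr fun i hi => by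
          have : i ≠ n + 1 := fun h => hmem (h ▸ hi)
          omega
      simp only [this, sub_self]
  have h := hinj.tsum_eq hsupp
  rw [hs.tsum_sub hs'] at h
  have h2 : ∀ m : Multiset ℕ, ((if ∀ i ∈ (n + 1) ::ₘ m, n < i then x ^ ((n + 1) ::ₘ m).sum else 0) -
      (if ∀ i ∈ (n + 1) ::ₘ m, n + 1 < i then x ^ ((n + 1) ::ₘ m).sum else 0)) =
        x ^ (n + 1) * (if ∀ i ∈ m, n < i then x ^ m.sum else 0) := by
    intro m
    simp [pow_add]
  simp only [h2, tsum_mul_left] at h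
  linear_combination h

/-- The generating function of the multisets of integers `> n`. -/
theorem tsum_multiset_pow_sum_mul {x : ℂ} (hx : ‖x‖ < 1) (n : ℕ) :
    (∑' m : Multiset ℕ, if ∀ i ∈ m, n < i then x ^ m.sum else 0) * qPochInf x x =
      qPoch x x n := by
  set B : ℕ → ℂ := fun n => ∑' m : Multiset ℕ, if ∀ i ∈ m, n < i then x ^ m.sum else 0
  have hB : ∀ n, B n = qPoch x x n * B 0 := by
    intro n
    induction n with
    | zero => rw [qPoch_zero, one_mul]
    | succ n ih =>
      rw [qPoch_self_succ]
      simp only [B] at ih ⊢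
      rw [tsum_multiset_pow_sum_succ hx, ih]
      ring
  have hlim : Tendsto B atTop (𝓝 (∑' m : Multiset ℕ, if m = 0 then 1 else 0)) := by
    refine tendsto_tsum_of_dominated_convergence (summable_norm_multiset_pow_sum hx 0)
      (fun m => ?_) (.of_forall fun n m => ?_)
    · refine tendsto_const_nhds.congr' ?_
      filter_upwards [eventually_ge_atTop m.sum] with n hn
      rcases eq_or_ne m 0 with rfl | hm
      · simp
      · rw [if_neg hm, if_neg]
        obtain ⟨i, hi⟩ := Multiset.exists_mem_of_ne_zero hm
        exact fun h => absurd (h i hi) (not_lt.2 ((Multiset.single_le_sum (by simp) i hi).trans hn))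
    · split_ifs with h1 h2 h2
      · exact le_rfl
      · exact absurd (fun i hi => Nat.zero_lt_of_lt (h1 i hi)) h2
      · simp
      · simp
  rw [tsum_ite_eq] at hlim
  have h1 := tendsto_nhds_unique hlim
    (((tendsto_qPoch x hx).mul_const (B 0)).congr fun n => (hB n).symm)
  change B n * _ = _
  rw [hB, mul_assoc, mul_comm (B 0), ← h1, mul_one]

theorem qPoch_sq (q : ℂ) (n : ℕ) :
    qPoch (q ^ 2) (q ^ 2) n = qPoch q q n * qPoch (-q) q n := by
  induction n with
  | zero => simp [qPoch_zero]
  | succ n ih => rw [qPoch_self_succ, qPoch_self_succ, qPoch_neg_succ, ih]; ring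

theorem norm_sq_lt_one {q : ℂ} (hq : ‖q‖ < 1) : ‖q ^ 2‖ < 1 := by
  rw [norm_pow]; exact pow_lt_one₀ (norm_nonneg q) hq two_ne_zero

theorem qPochInf_sq {q : ℂ} (hq : ‖q‖ < 1) :
    qPochInf (q ^ 2) (q ^ 2) = qPochInf q q * qPochInf (-q) q := by
  refine tendsto_nhds_unique (tendsto_qPoch _ (norm_sq_lt_one hq)) ?_
  exact ((tendsto_qPoch q hq).mul (tendsto_qPoch (-q) hq)).congr fun n => (qPoch_sq q n).symm

/-- The summand that belongs to the triple of a smallest part `n + 1`, a finite set of parts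
`> n + 1` and a multiset of parts `> n`, which stands for two equal partitions; it vanishes on the
triples that violate these inequalities. -/
noncomputable def tripleTerm (q : ℂ) (x : ℕ × Finset ℕ × Multiset ℕ) : ℂ :=
  q ^ (x.1 + 1) * ((∏ i ∈ x.2.1, if x.1 + 1 < i then -q ^ i else 0) *
    if ∀ i ∈ x.2.2, x.1 < i then (q ^ 2) ^ x.2.2.sum else 0)

theorem summable_norm_tripleTerm {q : ℂ} (hq : ‖q‖ < 1) : Summable fun x => ‖tripleTerm q x‖ := by
  have hg := summable_geometric_of_lt_one (norm_nonneg q) hq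
  have hf := summable_finsetProd_of_summable_nonneg (fun i => by positivity) hg
  have hm := summable_multiset_pow_sum (norm_nonneg (q ^ 2)) (norm_sq_lt_one hq)
  have hm0 : ∀ m : Multiset ℕ, 0 ≤ if ∀ i ∈ m, 0 < i then ‖q ^ 2‖ ^ m.sum else 0 :=
    fun m => by split_ifs <;> positivity
  have hfm := hf.mul_of_nonneg hm (fun _ => Finset.prod_nonneg fun _ _ => by positivity) hm0
  refine (hg.mul_of_nonneg hfm (fun _ => by positivity) fun x => mul_nonneg
    (Finset.prod_nonneg fun _ _ => by positivity) (hm0 _)).of_nonneg_of_le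
    (fun _ => norm_nonneg _) fun x => ?_
  rw [tripleTerm, norm_mul, norm_mul, norm_prod]
  refine mul_le_mul (norm_pow_le_pow_of_le hq (Nat.le_succ _)) (mul_le_mul ?_ ?_ (norm_nonneg _)
    (Finset.prod_nonneg fun _ _ => by positivity)) (by positivity) (by positivity)
  · refine Finset.prod_le_prod (fun _ _ => norm_nonneg _) fun i _ => ?_
    split_ifs <;> simp
  · split_ifs with h1 h2 h2
    · rw [norm_pow]
    · exact absurd (fun i hi => Nat.zero_lt_of_lt (h1 i hi)) h2
    · rw [norm_zero]; positivity
    · simp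

theorem tsum_tripleTerm {q : ℂ} (hq : ‖q‖ < 1) : ∑' x, tripleTerm q x =
    (qPochInf (-q) q)⁻¹ * ∑' m, qPoch (-q) q m * q ^ (m + 1) / (1 - q ^ (m + 1)) := by
  rw [(summable_norm_tripleTerm hq).of_norm.tsum_prod, ← tsum_mul_left]
  refine tsum_congr fun n => ?_
  simp only [tripleTerm]
  have hs : Summable fun i : ℕ => ‖if n + 1 < i then -q ^ i else 0‖ := by
    refine (summable_geometric_of_lt_one (norm_nonneg q) hq).of_nonneg_of_le
      (fun _ => norm_nonneg _) fun i => ?_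
    split_ifs <;> simp
  have hs' : Summable fun t : Finset ℕ => ‖∏ i ∈ t, (if n + 1 < i then -q ^ i else 0)‖ := by
    simp only [norm_prod]
    exact summable_finsetProd_of_summable_nonneg (fun _ => norm_nonneg _) hs
  rw [tsum_mul_left, ← tsum_mul_tsum_of_summable_norm hs'
    (summable_norm_multiset_pow_sum (norm_sq_lt_one hq) n), tsum_finset_prod_eq hq]
  have hB := tsum_multiset_pow_sum_mul (norm_sq_lt_one hq) n
  rw [qPochInf_sq hq, qPoch_sq] at hB
  have h1 := qPochInf_self_ne_zero hq
  have h2 := qPochInf_neg_ne_zero hq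
  have h3 := qPoch_self_ne_zero hq n
  have h4 := one_sub_pow_ne_zero hq n
  rw [← eq_div_iff (mul_ne_zero h1 h2)] at hB
  rw [hB, qPoch_self_succ]
  field_simp


/-! ### Self-conjugate `S`-partitions -/

theorem IntPartition.ext_parts {π π' : IntPartition} (h : π.2.parts = π'.2.parts) : π = π' := by
  obtain ⟨n, p⟩ := π
  obtain ⟨n', p'⟩ := π'
  obtain rfl : n = n' := by rw [← p.parts_sum, ← p'.parts_sum]; exact congrArg _ h
  exact congrArg _ (Nat.Partition.ext h)

/-- The partition with a given multiset of positive integers as parts. -/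
def ofParts (s : Multiset ℕ) (h : ∀ i ∈ s, 0 < i) : IntPartition := ⟨s.sum, s, h _, rfl⟩

theorem le_smallestPart_iff {π : IntPartition} {k : ℕ} :
    (k : ℕ∞) ≤ smallestPart π ↔ ∀ i ∈ π.2.parts, k ≤ i := by
  simp [smallestPart, Multiset.le_inf]

theorem smallestPart_eq {π : IntPartition} {k : ℕ} (hk : k ∈ π.2.parts)
    (h : ∀ i ∈ π.2.parts, k ≤ i) : smallestPart π = k :=
  le_antisymm (Multiset.inf_le (Multiset.mem_map_of_mem _ hk)) (le_smallestPart_iff.2 h)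

theorem parts_ne_zero_of_smallestPart_lt_top {π : IntPartition} (h : smallestPart π < ⊤) :
    π.2.parts ≠ 0 := fun h0 => by simp [smallestPart, h0] at h

/-- The conditions on the entries of `(n, t, m)` under which `n + 1` together with `t` forms the
first component of an `S`-partition whose other two components both have the parts `m`. -/
def IsAdmissible (x : ℕ × Finset ℕ × Multiset ℕ) : Prop :=
  (∀ i ∈ x.2.1, x.1 + 1 < i) ∧ ∀ i ∈ x.2.2, x.1 < i

theorem tripleTerm_eq (q : ℂ) {x : ℕ × Finset ℕ × Multiset ℕ} (h : IsAdmissible x) :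
    tripleTerm q x =
      (-1) ^ x.2.1.card * q ^ (x.1 + 1 + x.2.1.val.sum + x.2.2.sum + x.2.2.sum) := by
  have h3 : ∏ i ∈ x.2.1, (if x.1 + 1 < i then -q ^ i else 0) =
      (-1) ^ x.2.1.card * q ^ x.2.1.val.sum := by
    rw [Finset.sum_val, ← Finset.prod_pow_eq_pow_sum, ← Finset.prod_const, ← Finset.prod_mul_distrib]
    exact Finset.prod_congr rfl fun i hi => by rw [if_pos (h.1 i hi), neg_one_mul, id]
  rw [tripleTerm, h3, if_pos h.2]
  ring

theorem isAdmissible_of_tripleTerm_ne_zero {q : ℂ} {x : ℕ × Finset ℕ × Multiset ℕ}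
    (h : tripleTerm q x ≠ 0) : IsAdmissible x := by
  have h1 := left_ne_zero_of_mul (right_ne_zero_of_mul h)
  have h2 := right_ne_zero_of_mul (right_ne_zero_of_mul h)
  refine ⟨fun i hi => ?_, by_contra fun h3 => h2 (if_neg h3)⟩
  by_contra h3
  exact Finset.prod_ne_zero_iff.1 h1 i hi (if_neg h3)

/-- The partition with the distinct parts `n + 1` and `t`. -/
def headPartition (x : ℕ × Finset ℕ × Multiset ℕ) (h : IsAdmissible x) : IntPartition :=
  ofParts ((x.1 + 1) ::ₘ x.2.1.val) <| Multiset.forall_mem_cons.2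
    ⟨x.1.succ_pos, fun i hi => Nat.zero_lt_of_lt (h.1 i hi)⟩

theorem smallestPart_headPartition {x : ℕ × Finset ℕ × Multiset ℕ} (h : IsAdmissible x) :
    smallestPart (headPartition x h) = (x.1 + 1 : ℕ) :=
  smallestPart_eq (Multiset.mem_cons_self _ _)
    (Multiset.forall_mem_cons.2 ⟨le_rfl, fun i hi => (h.1 i hi).le⟩)

/-- The self-conjugate `S`-partition that an admissible triple stands for. -/
def ofTriple (x : ℕ × Finset ℕ × Multiset ℕ) (h : IsAdmissible x) : sPartitions :=
  ⟨⟨headPartition x h, ofParts x.2.2 fun i hi => Nat.zero_lt_of_lt (h.2 i hi),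
      ofParts x.2.2 fun i hi => Nat.zero_lt_of_lt (h.2 i hi)⟩,
    Multiset.nodup_cons.2 ⟨fun hn => (h.1 _ hn).false, x.2.1.nodup⟩,
    ⟨by rw [smallestPart_headPartition]; exact_mod_cast Nat.le_add_left 1 x.1,
      by rw [smallestPart_headPartition]; exact ENat.natCast_lt_top _⟩,
    by rw [smallestPart_headPartition, min_self]; exact le_smallestPart_iff.2 h.2⟩

theorem ofTriple_injective {x y : ℕ × Finset ℕ × Multiset ℕ}
    (hx : IsAdmissible x) (hy : IsAdmissible y) (h : ofTriple x hx = ofTriple y hy) : x = y := by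
  have h1 : x.1 = y.1 := by
    have := congrArg (fun π : sPartitions => smallestPart π.1.1) h
    simp only [ofTriple, smallestPart_headPartition] at this
    have : x.1 + 1 = y.1 + 1 := by exact_mod_cast this
    omega
  have h2 : (x.1 + 1) ::ₘ x.2.1.val = (y.1 + 1) ::ₘ y.2.1.val :=
    congrArg (fun π : sPartitions => π.1.1.2.parts) h
  have h3 : x.2.2 = y.2.2 := congrArg (fun π : sPartitions => π.1.2.1.2.parts) h
  rw [h1, Multiset.cons_inj_right, Finset.val_inj] at h2
  exact Prod.ext h1 (Prod.ext h2 h3)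

theorem exists_ofTriple_eq {π : sPartitions} (hπ : conjugate π = π) :
    ∃ x h, ofTriple x h = π := by
  have h23 : π.1.2.2 = π.1.2.1 := congrArg (fun π : sPartitions => π.1.2.1) hπ
  have hne := parts_ne_zero_of_smallestPart_lt_top π.2.2.1.2
  have hnd : π.1.1.2.parts.Nodup := π.2.1
  obtain ⟨s, hs, hmin⟩ := π.1.1.2.parts.toFinset.exists_min_image id
    (Multiset.toFinset_nonempty.2 hne)
  rw [Multiset.mem_toFinset] at hs
  have hmin : ∀ i ∈ π.1.1.2.parts, s ≤ i := fun i hi => hmin i (Multiset.mem_toFinset.2 hi)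
  have hpos : 0 < s := π.1.1.2.parts_pos hs
  have hle := π.2.2.2
  rw [h23, min_self, smallestPart_eq hs hmin, le_smallestPart_iff] at hle
  have h1 : s - 1 + 1 = s := by omega
  refine ⟨⟨s - 1, ⟨π.1.1.2.parts.erase s, hnd.erase s⟩, π.1.2.1.2.parts⟩,
    ⟨fun i hi => ?_, fun i hi => ?_⟩, ?_⟩
  · obtain ⟨h2, h3⟩ := hnd.mem_erase_iff.1 hi
    have := hmin i h3
    dsimp only
    omega
  · have := hle i hi
    dsimp only
    omega
  · refine Subtype.ext (Prod.ext ?_ (Prod.ext ?_ ?_)) <;> refine IntPartition.ext_parts ?_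
    · change (s - 1 + 1) ::ₘ π.1.1.2.parts.erase s = _
      rw [h1, Multiset.cons_erase hs]
    · rfl
    · rw [h23]; rfl

open Classical in
/-- The contribution of an `S`-partition to the generating function of `nSC`. -/
noncomputable def selfConjugateTerm (q : ℂ) (π : sPartitions) : ℂ :=
  if conjugate π = π then (weight π.1 : ℂ) * q ^ size π.1 else 0

theorem selfConjugateTerm_ofTriple (q : ℂ) {x : ℕ × Finset ℕ × Multiset ℕ} (h : IsAdmissible x) :
    selfConjugateTerm q (ofTriple x h) = tripleTerm q x := by
  rw [tripleTerm_eq q h, selfConjugateTerm,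
    if_pos (show conjugate (ofTriple x h) = ofTriple x h from rfl)]
  simp [weight, size, numParts, ofTriple, headPartition, ofParts]

theorem hasSum_selfConjugateTerm {q : ℂ} (hq : ‖q‖ < 1) :
    HasSum (selfConjugateTerm q) ((qPochInf (-q) q)⁻¹ *
      ∑' m, qPoch (-q) q m * q ^ (m + 1) / (1 - q ^ (m + 1))) := by
  rw [← tsum_tripleTerm hq]
  refine (hasSum_iff_hasSum_of_ne_zero_bij (g := tripleTerm q)
    (fun x => ofTriple x.1 (isAdmissible_of_tripleTerm_ne_zero x.2)) ?_ ?_ ?_).2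
    (summable_norm_tripleTerm hq).of_norm.hasSum
  · exact fun x y h => Subtype.ext (ofTriple_injective _ _ h)
  · intro π hπ
    have hc : conjugate π = π := by_contra fun hc => hπ (if_neg hc)
    obtain ⟨x, h, rfl⟩ := exists_ofTriple_eq hc
    exact ⟨⟨x, by rwa [Function.mem_support, selfConjugateTerm_ofTriple] at hπ⟩, rfl⟩
  · exact fun x => selfConjugateTerm_ofTriple q _

theorem nSC_zero : nSC 0 = 0 := by
  refine Finset.sum_eq_zero fun π hπ => ?_
  have h : size π.1 = 0 := ((Set.Finite.mem_toFinset _).1 hπ).1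
  obtain ⟨i, hi⟩ := Multiset.exists_mem_of_ne_zero
    (parts_ne_zero_of_smallestPart_lt_top π.2.2.1.2)
  have h1 := π.1.1.2.parts_pos hi
  have h2 := Nat.Partition.le_of_mem_parts hi
  simp only [size] at h
  omega

theorem hasSum_nSC_mul_pow {q : ℂ} (hq : ‖q‖ < 1) :
    HasSum (fun m => (nSC (m + 1) : ℂ) * q ^ (m + 1)) ((qPochInf (-q) q)⁻¹ *
      ∑' m, qPoch (-q) q m * q ^ (m + 1) / (1 - q ^ (m + 1))) := by
  have h := (hasSum_selfConjugateTerm hq).tsum_fiberwise fun π => size π.1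
  have h1 : ∀ n, ∑' π : (fun π : sPartitions => size π.1) ⁻¹' {n}, selfConjugateTerm q π =
      (nSC n : ℂ) * q ^ n := by
    intro n
    rw [tsum_subtype, tsum_eq_sum (s := (finite_selfConjugate n).toFinset) fun π hπ => ?_]
    · rw [nSC, Int.cast_sum, Finset.sum_mul]
      refine Finset.sum_congr rfl fun π hπ => ?_
      obtain ⟨h2, h3⟩ := (Set.Finite.mem_toFinset _).1 hπ
      rw [Set.indicator_of_mem (by exact h2), selfConjugateTerm, if_pos h3, h2]
    · rw [Set.Finite.mem_toFinset] at hπ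
      refine Set.indicator_apply_eq_zero.2 fun h2 => if_neg fun h3 => hπ ⟨h2, h3⟩
  simp only [h1] at h
  rw [← hasSum_nat_add_iff' 1] at h
  simpa [nSC_zero] using h

end QSeries

theorem corollary2p12 (q : ℂ) (hq : ‖q‖ < 1) :
    (Summable fun m : ℕ => (QSeries.nSC (m + 1) : ℂ) * q ^ (m + 1)) ∧
    (Summable fun m : ℕ =>
      q ^ ((m + 1) * (m + 2) / 2) / ((1 - q ^ (m + 1)) * QSeries.qPoch q q (m + 1)) *
        (QSeries.qPoch (-q) q (m + 1) / QSeries.qPoch q q (m + 1) - 1)) ∧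
    (Summable fun m : ℕ =>
      QSeries.qPoch (-q) q (m + 1) / QSeries.qPoch q q (m + 1) *
        (q ^ (m + 1) / (1 - q ^ (m + 1)))) ∧
    QSeries.qPochInf q q * ∑' m : ℕ, (QSeries.nSC (m + 1) : ℂ) * q ^ (m + 1) +
      1 / 2 * (QSeries.qPochInf q q / QSeries.qPochInf (-q) q) *
        ∑' m : ℕ,
          q ^ ((m + 1) * (m + 2) / 2) / ((1 - q ^ (m + 1)) * QSeries.qPoch q q (m + 1)) *
            (QSeries.qPoch (-q) q (m + 1) / QSeries.qPoch q q (m + 1) - 1) =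
    1 / 4 - 1 / 4 * (QSeries.qPochInf q q / QSeries.qPochInf (-q) q) +
      1 / 2 * (QSeries.qPochInf q q / QSeries.qPochInf (-q) q) *
        ∑' m : ℕ,
          QSeries.qPoch (-q) q (m + 1) / QSeries.qPoch q q (m + 1) *
            (q ^ (m + 1) / (1 - q ^ (m + 1))) := by
  have hN := QSeries.hasSum_nSC_mul_pow hq
  refine ⟨hN.summable, QSeries.summable_pow_triangular_div hq,
    (QSeries.hasSum_qPoch_neg_div_mul_pow_div hq).summable, ?_⟩
  rw [hN.tsum_eq]
  exact QSeries.qPoch_series_identity hq
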